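/- Throughout, graphs are finite, undirected and without loops, with vertex set $\{1,\dots,n\}$; $n$ is the order of the graph, and $A_G\in\{0,1\}^{n\times n}$ denotes the adjacency matrix of $G$. Consider expressions $e(X)$ in a single matrix variable $X$, which stands for a square complex matrix, built from $X$ by matrix multiplication $e_1\cdot e_2$, trace $\mathsf{tr}(e)$ (a $1\times 1$ matrix), conjugate transposition $e^*$, the one-vector $\mathbb{1}(e)$ (the all-ones column vector with as many rows as $e$), and pointwise multiplication $e_1\odot_v e_2$ of column vectors of the same length. Only well-formed expressions are considered: each is typed with a number of rows and of columns in $\{1,\alpha\}$, where $X$ has type $\alpha\times\alpha$ and the operations respect the types. A sentence is an expression of type $1\times 1$. Two graphs $G$ and $H$ of the same order are $\mathsf{ML}(\cdot,\mathsf{tr},{}^*,\mathbb{1},\odot_v)$-equivalent, written $G\equiv_{\mathsf{ML}(\cdot,\mathsf{tr},{}^*,\mathbb{1},\odot_v)}H$, if $e(A_G)=e(A_H)$ for every sentence $e(X)$. An equitable partition of $G$ is a partition $\mathcal V=\{V_1,\dots,V_\ell\}$ of its vertex set such that for all $i,j$ and all $v,v'\in V_i$ one has $\deg_G(v,V_j)=\deg_G(v',V_j)$,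 where $\deg_G(v,S)$ is the number of neighbours of $v$ in $S$. Equitable partitions $\mathcal V=\{V_1,\dots,V_\ell\}$ of $G$ and $\mathcal W=\{W_1,\dots,W_\ell\}$ of $H$ witness that $G$ and $H$ have a common equitable partition if $|V_i|=|W_i|$ for all $i$, and $\deg_G(v,V_j)=\deg_H(w,W_j)$ for all $i,j$, $v\in V_i$ and $w\in W_i$. For a set $S$ of vertices, $\mathbb{1}_S\in\mathbb{R}^{n}$ is its indicator (column) vector. A matrix $T$ preserves $\mathcal V$ and $\mathcal W$ if $\mathbb{1}_{V_i}=T\cdot\mathbb{1}_{W_i}$ for all $i=1,\dots,\ell$. **Theorem.** Let $G$ and $H$ be two graphs of the same order, and let $\mathcal V$ and $\mathcal W$ be equitable partitions of $G$ and $H$, respectively, that witness that $G$ and $H$ have a common equitable partition. Then $G\equiv_{\mathsf{ML}(\cdot,\mathsf{tr},{}^*,\mathbb{1},\odot_v)}H$ if and only if there exists a real orthogonal $n\times n$ matrix $O$ which preserves $\mathcal V$ and $\mathcal W$ and satisfies $A_G\cdot O=O\cdot A_H$. -/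

import Mathlib

open scoped Matrix

/-- Size symbols for the type system of matrix expressions over one square matrix variable:
`one` stands for `1`, and `size` for the number of rows and columns of the input matrix. -/
inductive SizeSym : Type
  | one : SizeSym
  | size : SizeSym

/-- The actual dimension denoted by a size symbol when the input matrix is `n × n`. -/
abbrev SizeSym.toNat (n : ℕ) : SizeSym → ℕ
  | SizeSym.one => 1
  | SizeSym.size => n

/-- Well-formed expressions `e(X)` of the fragment `ML(·, tr, *, 𝟙, ⊙_v)` of MATLANG in the single
matrix variable `X`. An element of `MLExpr a b` is an expression returning an `a × b` matrix. -/
inductive MLExpr : SizeSym → SizeSym → Type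
  /-- The matrix variable `X`. -/
  | var : MLExpr SizeSym.size SizeSym.size
  /-- Matrix multiplication `e₁ · e₂`. -/
  | mul {a b c : SizeSym} (e₁ : MLExpr a b) (e₂ : MLExpr b c) : MLExpr a c
  /-- Trace `tr(e)`, a `1 × 1` matrix. -/
  | tr {a : SizeSym} (e : MLExpr a a) : MLExpr SizeSym.one SizeSym.one
  /-- Conjugate transposition `e*`. -/
  | conjT {a b : SizeSym} (e : MLExpr a b) : MLExpr b a
  /-- One-vector `𝟙(e)`: the all-ones column vector with as many rows as `e`. -/
  | ones {a b : SizeSym} (e : MLExpr a b) : MLExpr a SizeSym.one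
  /-- Pointwise multiplication `e₁ ⊙_v e₂` of column vectors. -/
  | vmul {a : SizeSym} (e₁ e₂ : MLExpr a SizeSym.one) : MLExpr a SizeSym.one

/-- The value `e(A)` of an expression `e(X)` on a complex `n × n` matrix `A`. -/
def MLExpr.eval {n : ℕ} (A : Matrix (Fin n) (Fin n) ℂ) :
    {a b : SizeSym} → MLExpr a b → Matrix (Fin (a.toNat n)) (Fin (b.toNat n)) ℂ
  | _, _, .var => A
  | _, _, .mul e₁ e₂ => e₁.eval A * e₂.eval A
  | _, _, .tr e => Matrix.of fun _ _ => (e.eval A).trace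
  | _, _, .conjT e => (e.eval A)ᴴ
  | _, _, .ones _ => Matrix.of fun _ _ => 1
  | _, _, .vmul e₁ e₂ => Matrix.of fun i j => e₁.eval A i j * e₂.eval A i j

/-- A sentence is an expression that returns a `1 × 1` matrix. -/
abbrev MLSentence : Type := MLExpr SizeSym.one SizeSym.one

/-- `A` and `B` are `ML(·, tr, *, 𝟙, ⊙_v)`-equivalent: no sentence distinguishes them. -/
def MLMatrixEquiv {n : ℕ} (A B : Matrix (Fin n) (Fin n) ℂ) : Prop :=
  ∀ e : MLSentence, e.eval A = e.eval B

/-- Two graphs of the same order are `ML(·, tr, *, 𝟙, ⊙_v)`-equivalent if their adjacency matrices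
are. -/
def MLGraphEquiv {n : ℕ} (G H : SimpleGraph (Fin n)) [DecidableRel G.Adj] [DecidableRel H.Adj] :
    Prop :=
  MLMatrixEquiv (G.adjMatrix ℂ) (H.adjMatrix ℂ)

/-- `deg(v, S)`: the number of vertices in `S` that are adjacent to `v`. -/
def degInto {n : ℕ} (G : SimpleGraph (Fin n)) [DecidableRel G.Adj] (v : Fin n)
    (S : Finset (Fin n)) : ℕ :=
  (S.filter fun u => G.Adj v u).card

/-- `P₁, …, P_ℓ` is an enumeration, without repetition, of an equitable partition of `G`. -/
structure IsEquitablePartition {n l : ℕ} (G : SimpleGraph (Fin n)) [DecidableRel G.Adj]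
    (P : Fin l → Finset (Fin n)) : Prop where
  nonempty : ∀ i, (P i).Nonempty
  disjoint : ∀ i j, i ≠ j → Disjoint (P i) (P j)
  cover : ∀ v, ∃ i, v ∈ P i
  deg_eq : ∀ i j, ∀ v ∈ P i, ∀ v' ∈ P i, degInto G v (P j) = degInto G v' (P j)

/-- The equitable partitions `P` of `G` and `Q` of `H` witness that `G` and `H` have a common
equitable partition. -/
structure WitnessCommonEquitablePartition {n l : ℕ} (G H : SimpleGraph (Fin n))
    [DecidableRel G.Adj] [DecidableRel H.Adj] (P Q : Fin l → Finset (Fin n)) : Prop where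
  left : IsEquitablePartition G P
  right : IsEquitablePartition H Q
  card_eq : ∀ i, (P i).card = (Q i).card
  deg_eq : ∀ i j, ∀ v ∈ P i, ∀ w ∈ Q i, degInto G v (P j) = degInto H w (Q j)

/-- The indicator vector of a set of vertices. -/
def indicatorVec {n : ℕ} (S : Finset (Fin n)) : Fin n → ℝ :=
  fun v => if v ∈ S then 1 else 0

/-- `T` preserves the partitions `P` and `Q`: it maps the indicator vector of the `i`-th part of
`Q` to that of the `i`-th part of `P`. -/
def PreservesPartitions {n l : ℕ} (T : Matrix (Fin n) (Fin n) ℝ)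
    (P Q : Fin l → Finset (Fin n)) : Prop :=
  ∀ i, indicatorVec (P i) = T *ᵥ indicatorVec (Q i)

namespace Matrix

/-! Let `S`, `T` have the part indicators of `G`, `H` as columns, and let `A`, `B` be the adjacency
matrices. Common equitability says `A * S = S * C` and `B * T = T * C` with one degree matrix `C`,
and `S`, `T` have the same Gram matrix. Forward, only the sentences `tr(X^k)` are needed. The
projections `P`, `Q` onto the column spaces commute with `A`, `B`, and `A`, `B` have the same power
traces there, those of `C`, hence also on the complements. Replacing both operators on the column
spaces by a scalar `c` outside both spectra keeps power traces equal, so an orthogonal `U`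
intertwines the results; it matches the `c`-eigenspaces, hence the complements. Gluing `U` on the
complement to `T ↦ S` gives `O` (`exists_orthogonal_of_invariant_columns`). Backward, induction on
expressions (`PartCompatible.eval`): values stay intertwined by `O` and respect the parts. Column
values are then constant on parts with the same constants for `G` and `H`, which is what makes
pointwise products harmless. -/

theorem one_submatrix_mul_eq_submatrix {m n o R : Type*} [Fintype n] [DecidableEq n]
    [NonAssocSemiring R] (p : m → n) (C : Matrix n o R) :
    (1 : Matrix n n R).submatrix p id * C = C.submatrix p id :=
  one_submatrix_mul p (Equiv.refl n) C

/-! ### Power traces determine a real symmetric matrix up to orthogonal similarity -/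

section TracePowers

variable {n : Type*} [Fintype n]

/-- Two finite families of reals with the same power sums agree up to order. -/
theorem map_univ_eq_of_sum_pow_eq {x y : n → ℝ} (h : ∀ k : ℕ, ∑ i, x i ^ k = ∑ i, y i ^ k) :
    (Finset.univ.val.map x : Multiset ℝ) = Finset.univ.val.map y := by
  classical
  have hpoly : ∀ f : Polynomial ℝ, ∑ i, f.eval (x i) = ∑ i, f.eval (y i) := fun f => by
    simp_rw [Polynomial.eval_eq_sum_range]
    rw [Finset.sum_comm, Finset.sum_comm (s := Finset.univ) (t := Finset.range _)]
    simp_rw [← Finset.mul_sum, h]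
  ext a
  let s : Finset ℝ := (Finset.univ.image x ∪ Finset.univ.image y).erase a
  -- `f` vanishes at every value of either family except `a`, so summing it isolates the
  -- multiplicity of `a`.
  let f : Polynomial ℝ := ∏ b ∈ s, (Polynomial.X - Polynomial.C b)
  have hfa : f.eval a ≠ 0 := by
    simp only [f, Polynomial.eval_prod, Polynomial.eval_sub, Polynomial.eval_X, Polynomial.eval_C]
    refine Finset.prod_ne_zero_iff.2 fun b hb => sub_ne_zero.2 fun hab => ?_
    exact Finset.ne_of_mem_erase hb hab.symm
  have hf0 : ∀ b ∈ s, f.eval b = 0 := fun b hb => by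
    simp only [f, Polynomial.eval_prod, Polynomial.eval_sub, Polynomial.eval_X, Polynomial.eval_C]
    exact Finset.prod_eq_zero hb (sub_self b)
  have key : ∀ z : n → ℝ, (∀ i, z i ≠ a → z i ∈ s) →
      ∑ i, f.eval (z i) = f.eval a * (Multiset.count a (Finset.univ.val.map z) : ℝ) := by
    intro z hz
    have : ∀ i, f.eval (z i) = if a = z i then f.eval a else 0 := fun i => by
      split_ifs with hi
      · rw [← hi]
      · exact hf0 _ (hz i (Ne.symm hi))
    rw [Finset.sum_congr rfl fun i _ => this i, ← Finset.sum_filter, Finset.sum_const,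
      Multiset.count_map, nsmul_eq_mul, mul_comm]
    rfl
  have hx := key x fun i hi => Finset.mem_erase.2 ⟨hi, by simp⟩
  have hy := key y fun i hi => Finset.mem_erase.2 ⟨hi, by simp⟩
  have := (hx.symm.trans (hpoly f)).trans hy
  exact_mod_cast mul_left_cancel₀ hfa this

variable [DecidableEq n] {A B : Matrix n n ℝ}

theorem IsHermitian.trace_pow_eq_sum_eigenvalues_pow (hA : A.IsHermitian) (k : ℕ) :
    (A ^ k).trace = ∑ i, hA.eigenvalues i ^ k := by
  conv_lhs => rw [hA.spectral_theorem]
  rw [← map_pow, Unitary.conjStarAlgAut_apply, trace_mul_cycle, Unitary.coe_star_mul_self,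
    one_mul, diagonal_pow, trace_diagonal]
  simp

/-- Real symmetric matrices whose powers have the same traces are orthogonally similar. -/
theorem IsHermitian.exists_orthogonal_of_trace_pow_eq (hA : A.IsHermitian) (hB : B.IsHermitian)
    (h : ∀ k : ℕ, (A ^ k).trace = (B ^ k).trace) :
    ∃ O ∈ orthogonalGroup n ℝ, A * O = O * B := by
  have hms := map_univ_eq_of_sum_pow_eq (x := hA.eigenvalues) (y := hB.eigenvalues) fun k => by
    rw [← hA.trace_pow_eq_sum_eigenvalues_pow, ← hB.trace_pow_eq_sum_eigenvalues_pow, h]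
  have hchar : A.charpoly = B.charpoly := by
    have aux : ∀ z : n → ℝ, ∏ i, (Polynomial.X - Polynomial.C (z i)) =
        ((Finset.univ.val.map z).map fun a => Polynomial.X - Polynomial.C a).prod := fun z => by
      rw [Multiset.map_map]; rfl
    rw [hA.charpoly_eq, hB.charpoly_eq]
    exact (aux _).trans (hms ▸ (aux _).symm)
  have hev := (IsHermitian.eigenvalues_eq_eigenvalues_iff hA hB).2 hchar
  -- Both matrices diagonalize to the same `D`; pass from one eigenbasis to the other.
  refine ⟨_, (hA.eigenvectorUnitary * star hB.eigenvectorUnitary).2, ?_⟩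
  have h1 := hA.spectral_theorem
  have h2 := hB.spectral_theorem
  rw [Unitary.conjStarAlgAut_apply] at h1 h2
  rw [← hev] at h2
  set D : Matrix n n ℝ := diagonal (RCLike.ofReal ∘ hA.eigenvalues)
  set U := hA.eigenvectorUnitary
  set W := hB.eigenvectorUnitary
  have hU : (star U : Matrix n n ℝ) * U = 1 := Unitary.coe_star_mul_self U
  have hW : (star W : Matrix n n ℝ) * W = 1 := Unitary.coe_star_mul_self W
  rw [h1, h2]
  simp only [Submonoid.coe_mul, Unitary.coe_star] at *
  calc (U : Matrix n n ℝ) * D * star (U : Matrix n n ℝ) * (U * star (W : Matrix n n ℝ))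
      = U * D * (star (U : Matrix n n ℝ) * U) * star (W : Matrix n n ℝ) := by
        simp only [Matrix.mul_assoc]
    _ = U * (star (W : Matrix n n ℝ) * W) * D * star (W : Matrix n n ℝ) := by
        rw [hU, hW, Matrix.mul_one, Matrix.mul_one]
    _ = _ := by simp only [Matrix.mul_assoc]

end TracePowers

/-! ### Replacing an operator by a scalar on an invariant subspace -/

section Deflation

variable {n : Type*} [Fintype n] [DecidableEq n] {A P : Matrix n n ℝ} {c : ℝ}

/-- If `c` is not an eigenvalue of `A`, the `c`-eigenspace of `A (1 - P) + c P` is the range of the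
idempotent `P`. -/
theorem mul_eq_self_of_deflation_mul_eq (hPP : P * P = P) (hAP : A * P = P * A)
    (hc : c ∉ spectrum ℝ A) {M : Matrix n n ℝ} (hM : (A * (1 - P) + c • P) * M = c • M) :
    P * M = M := by
  have hu : IsUnit (algebraMap ℝ (Matrix n n ℝ) c - A) := spectrum.notMem_iff.1 hc
  have h1 : (1 - P) * (A * (1 - P) + c • P) = A * (1 - P) := by
    have : P * (A * P) = A * P := by rw [← Matrix.mul_assoc, ← hAP, Matrix.mul_assoc, hPP]
    simp only [Matrix.mul_add, Matrix.sub_mul, Matrix.mul_sub, Matrix.one_mul, Matrix.mul_one,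
      Matrix.mul_smul, hPP, this, ← hAP, sub_self, smul_zero, sub_zero, add_zero]
  -- Nonzero columns of `(1 - P) * M` would be eigenvectors of `A` for `c`.
  have h2 : (algebraMap ℝ (Matrix n n ℝ) c - A) * ((1 - P) * M) = 0 := by
    have h3 : A * ((1 - P) * M) = c • ((1 - P) * M) := by
      rw [← Matrix.mul_assoc, ← h1, Matrix.mul_assoc, hM, Matrix.mul_smul]
    rw [Matrix.sub_mul, h3, ← Algebra.smul_def, sub_self]
  have h4 : (1 - P) * M = 0 := (hu.mul_right_eq_zero).1 h2
  rw [Matrix.sub_mul, Matrix.one_mul, sub_eq_zero] at h4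
  exact h4.symm

theorem deflation_pow (hPP : P * P = P) (hAP : A * P = P * A) (k : ℕ) :
    (A * (1 - P) + c • P) ^ k = A ^ k - A ^ k * P + c ^ k • P := by
  induction k with
  | zero => simp
  | succ k ih =>
    have h1 : P * (A * P) = A * P := by rw [← Matrix.mul_assoc, ← hAP, Matrix.mul_assoc, hPP]
    rw [pow_succ, ih, pow_succ, pow_succ]
    simp only [Matrix.mul_add, Matrix.add_mul, Matrix.sub_mul, Matrix.mul_sub, Matrix.mul_one,
      Matrix.mul_smul, Matrix.smul_mul, Matrix.mul_assoc, hPP, h1, ← hAP]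
    module

end Deflation

/-! ### Symmetric matrices acting alike on spanning columns of invariant subspaces -/

section InvariantColumns

variable {n k : Type*} [Fintype n] [Fintype k] [DecidableEq k]

/-- The projection onto the column space of `S`, when `Sᵀ * S` is invertible. -/
noncomputable def colProj (S : Matrix n k ℝ) : Matrix n n ℝ := S * (Sᵀ * S)⁻¹ * Sᵀ

variable {S : Matrix n k ℝ}

theorem colProj_transpose : (colProj S)ᵀ = colProj S := by
  simp [colProj, transpose_mul, transpose_nonsing_inv, Matrix.mul_assoc]

theorem colProj_mul_self (hS : IsUnit (Sᵀ * S).det) : colProj S * S = S := by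
  rw [colProj, Matrix.mul_assoc, Matrix.mul_assoc, nonsing_inv_mul _ hS, Matrix.mul_one]

theorem colProj_mul_colProj (hS : IsUnit (Sᵀ * S).det) :
    colProj S * colProj S = colProj S := by
  calc colProj S * (S * (Sᵀ * S)⁻¹ * Sᵀ) = colProj S * S * (Sᵀ * S)⁻¹ * Sᵀ := by
        simp only [Matrix.mul_assoc]
    _ = colProj S := by rw [colProj_mul_self hS, colProj]

variable {A : Matrix n n ℝ} {C : Matrix k k ℝ}

/-- Since `Sᵀ * A * S` is symmetric, `C` is self-adjoint for the Gram form; this is that fact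
conjugated by the inverse Gram matrix. -/
theorem mul_gram_inv_eq (hS : IsUnit (Sᵀ * S).det) (hA : Aᵀ = A) (hAS : A * S = S * C) :
    C * (Sᵀ * S)⁻¹ = (Sᵀ * S)⁻¹ * Cᵀ := by
  have h1 : (Sᵀ * S) * C = Cᵀ * (Sᵀ * S) := by
    have := congrArg transpose hAS
    rw [transpose_mul, transpose_mul, hA] at this
    rw [Matrix.mul_assoc, ← hAS, ← Matrix.mul_assoc, this, Matrix.mul_assoc]
  calc C * (Sᵀ * S)⁻¹ = (Sᵀ * S)⁻¹ * ((Sᵀ * S) * C) * (Sᵀ * S)⁻¹ := by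
        rw [← Matrix.mul_assoc, nonsing_inv_mul _ hS, Matrix.one_mul]
    _ = (Sᵀ * S)⁻¹ * Cᵀ := by
        rw [h1, ← Matrix.mul_assoc, Matrix.mul_assoc, mul_nonsing_inv _ hS, Matrix.mul_one]

theorem colProj_comm (hS : IsUnit (Sᵀ * S).det) (hA : Aᵀ = A) (hAS : A * S = S * C) :
    A * colProj S = colProj S * A := by
  have h : Sᵀ * A = Cᵀ * Sᵀ := by
    have := congrArg transpose hAS
    rwa [transpose_mul, transpose_mul, hA] at this
  rw [colProj, Matrix.mul_assoc _ _ A, h, ← Matrix.mul_assoc, ← Matrix.mul_assoc, hAS,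
    Matrix.mul_assoc S C, mul_gram_inv_eq hS hA hAS]
  simp only [Matrix.mul_assoc]

variable [DecidableEq n]

theorem pow_mul_eq_mul_pow (hAS : A * S = S * C) (m : ℕ) : A ^ m * S = S * C ^ m := by
  induction m with
  | zero => simp
  | succ m ih => rw [pow_succ, Matrix.mul_assoc, hAS, ← Matrix.mul_assoc, ih, pow_succ,
      Matrix.mul_assoc]

/-- `C` is the matrix of `A` on the column space in the basis `S`. The value depends on `C` alone,
so it is shared by both graphs. -/
theorem trace_pow_mul_colProj (hS : IsUnit (Sᵀ * S).det) (hAS : A * S = S * C) (m : ℕ) :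
    (A ^ m * colProj S).trace = (C ^ m).trace := by
  rw [colProj, ← Matrix.mul_assoc, ← Matrix.mul_assoc, pow_mul_eq_mul_pow hAS, trace_mul_comm,
    ← Matrix.mul_assoc, ← Matrix.mul_assoc, trace_mul_comm, ← Matrix.mul_assoc,
    nonsing_inv_mul _ hS, Matrix.one_mul]

/-- Two cospectral real symmetric matrices which act in the same way on tuples `S` and `T` of
linearly independent columns with the same Gram matrix are intertwined by an orthogonal matrix
mapping `T` to `S`. -/
theorem exists_orthogonal_of_invariant_columns {B : Matrix n n ℝ} {T : Matrix n k ℝ}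
    (hST : Sᵀ * S = Tᵀ * T) (hS : IsUnit (Sᵀ * S).det) (hA : Aᵀ = A) (hB : Bᵀ = B)
    (hAS : A * S = S * C) (hBT : B * T = T * C)
    (htr : ∀ m : ℕ, (A ^ m).trace = (B ^ m).trace) :
    ∃ O ∈ orthogonalGroup n ℝ, S = O * T ∧ A * O = O * B := by
  have hT : IsUnit (Tᵀ * T).det := hST ▸ hS
  obtain ⟨c, hc⟩ := ((A.finite_real_spectrum.union B.finite_real_spectrum).infinite_compl).nonempty
  have hcA : c ∉ spectrum ℝ A := fun h => hc (Or.inl h)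
  have hcB : c ∉ spectrum ℝ B := fun h => hc (Or.inr h)
  have hPP := colProj_mul_colProj hS
  have hQQ := colProj_mul_colProj hT
  have hAP := colProj_comm hS hA hAS
  have hBQ := colProj_comm hT hB hBT
  have hPS := colProj_mul_self hS
  have hQT := colProj_mul_self hT
  have hPt : (colProj S)ᵀ = colProj S := colProj_transpose
  have hQt : (colProj T)ᵀ = colProj T := colProj_transpose
  have htrP := trace_pow_mul_colProj hS hAS
  have htrQ := trace_pow_mul_colProj hT hBT
  have hQdef : colProj T = T * (Sᵀ * S)⁻¹ * Tᵀ := by rw [hST]; rfl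
  set P := colProj S
  set Q := colProj T
  have symm_defl : ∀ {X R : Matrix n n ℝ}, Xᵀ = X → Rᵀ = R → X * R = R * X →
      (X * (1 - R) + c • R)ᵀ = X * (1 - R) + c • R := fun hX hR h => by
    simp [transpose_mul, hX, hR, Matrix.mul_sub, h]
  have hA' := symm_defl hA hPt hAP
  have hB' := symm_defl hB hQt hBQ
  obtain ⟨U, hU, hAU⟩ := IsHermitian.exists_orthogonal_of_trace_pow_eq
    (A := A * (1 - P) + c • P) (B := B * (1 - Q) + c • Q)
    ((conjTranspose_eq_transpose_of_trivial _).trans hA')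
    ((conjTranspose_eq_transpose_of_trivial _).trans hB') fun m => by
      have hP0 := htrP 0
      have hQ0 := htrQ 0
      rw [pow_zero, Matrix.one_mul] at hP0 hQ0
      rw [deflation_pow hPP hAP, deflation_pow hQQ hBQ]
      simp only [trace_add, trace_sub, trace_smul, htr, htrP, htrQ, hP0, hQ0]
  have hUU : Uᵀ * U = 1 := (mem_orthogonalGroup_iff' _ _).1 hU
  have defl_mul : ∀ {X R : Matrix n n ℝ}, R * R = R → (X * (1 - R) + c • R) * R = c • R :=
    fun h => by simp [Matrix.add_mul, Matrix.mul_assoc, Matrix.sub_mul, h]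
  -- `U` carries the range of `Q` into the `c`-eigenspace, which is the range of `P`; the transposed
  -- relation gives the converse inclusion.
  have hPU : P * U = U * Q := by
    have h1 : P * (U * Q) = U * Q := mul_eq_self_of_deflation_mul_eq hPP hAP hcA (by
      rw [← Matrix.mul_assoc, hAU, Matrix.mul_assoc, defl_mul hQQ, Matrix.mul_smul])
    have hBU : (B * (1 - Q) + c • Q) * Uᵀ = Uᵀ * (A * (1 - P) + c • P) := by
      have := congrArg transpose hAU
      rw [transpose_mul, transpose_mul, hA', hB'] at this
      exact this.symm
    have h2 : Q * (Uᵀ * P) = Uᵀ * P := mul_eq_self_of_deflation_mul_eq hQQ hBQ hcB (by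
      rw [← Matrix.mul_assoc, hBU, Matrix.mul_assoc, defl_mul hPP, Matrix.mul_smul])
    have h3 := congrArg transpose h2
    simp only [transpose_mul, transpose_transpose, hPt, hQt] at h3
    rw [← h3, Matrix.mul_assoc, h1]
  -- The scalar parts cancel because `P * U = U * Q`, leaving the intertwining on the complements.
  have hAU1 : A * U * (1 - Q) = U * (1 - Q) * B := by
    have h1 : A * U * (1 - Q) = A * (1 - P) * U := by
      simp only [Matrix.mul_sub, Matrix.sub_mul, Matrix.mul_one, Matrix.mul_assoc, hPU]
    have h2 : A * (1 - P) = (A * (1 - P) + c • P) - c • P := by abel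
    rw [h1, h2, Matrix.sub_mul, hAU, Matrix.smul_mul, hPU]
    simp only [Matrix.mul_sub, Matrix.sub_mul, Matrix.mul_add, Matrix.mul_one, Matrix.mul_assoc,
      Matrix.mul_smul, hBQ]
    abel
  set E := (Sᵀ * S)⁻¹
  have hEt : Eᵀ = E := by simp [E, transpose_nonsing_inv, transpose_mul]
  have hES : E * (Sᵀ * S) = 1 := nonsing_inv_mul _ hS
  have hET : E * (Tᵀ * T) = 1 := hST ▸ hES
  have hCE : C * E = E * Cᵀ := mul_gram_inv_eq hS hA hAS
  have hTB : Tᵀ * B = Cᵀ * Tᵀ := by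
    have := congrArg transpose hBT
    rwa [transpose_mul, transpose_mul, hB] at this
  have hQT0 : (1 - Q) * T = 0 := by rw [Matrix.sub_mul, Matrix.one_mul, hQT, sub_self]
  have hSU0 : Sᵀ * (U * (1 - Q)) = 0 := by
    have h1 : U * (1 - Q) = (1 - P) * U := by
      rw [Matrix.mul_sub, Matrix.sub_mul, hPU, Matrix.mul_one, Matrix.one_mul]
    have h2 : Sᵀ * (1 - P) = 0 := by
      have : ((1 - P) * S)ᵀ = 0 := by
        rw [Matrix.sub_mul, Matrix.one_mul, hPS, sub_self, transpose_zero]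
      rwa [transpose_mul, transpose_sub, transpose_one, hPt] at this
    rw [h1, ← Matrix.mul_assoc, h2, Matrix.zero_mul]
  have hSU0' : (1 - Q) * Uᵀ * S = 0 := by
    have := congrArg transpose hSU0
    simpa [transpose_mul, hQt] using this
  -- The first summand sends `T` to `S`, isometrically on column spaces as the Gram matrices agree;
  -- the second is `U` on the orthogonal complement.
  refine ⟨S * E * Tᵀ + U * (1 - Q), (mem_orthogonalGroup_iff' _ _).2 ?_, ?_, ?_⟩
  · have h1 : (S * E * Tᵀ + U * (1 - Q))ᵀ = T * E * Sᵀ + (1 - Q) * Uᵀ := by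
      simp [transpose_mul, hQt, hEt, Matrix.mul_assoc]
    have e1 : T * E * Sᵀ * (S * E * Tᵀ) = Q := by
      calc T * E * Sᵀ * (S * E * Tᵀ) = T * (E * (Sᵀ * S)) * E * Tᵀ := by
            simp only [Matrix.mul_assoc]
        _ = Q := by rw [hES, Matrix.mul_one, hQdef]
    have e2 : T * E * Sᵀ * (U * (1 - Q)) = 0 := by
      rw [Matrix.mul_assoc, hSU0, Matrix.mul_zero]
    have e3 : (1 - Q) * Uᵀ * (S * E * Tᵀ) = 0 := by
      rw [← Matrix.mul_assoc, ← Matrix.mul_assoc, hSU0', Matrix.zero_mul, Matrix.zero_mul]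
    have e4 : (1 - Q) * Uᵀ * (U * (1 - Q)) = 1 - Q := by
      rw [Matrix.mul_assoc, ← Matrix.mul_assoc Uᵀ, hUU, Matrix.one_mul, Matrix.mul_sub,
        Matrix.mul_one, Matrix.sub_mul, Matrix.one_mul, hQQ, sub_self, sub_zero]
    rw [h1, Matrix.add_mul, Matrix.mul_add, Matrix.mul_add, e1, e2, e3, e4]
    abel
  · rw [Matrix.add_mul, Matrix.mul_assoc U, hQT0, Matrix.mul_zero, add_zero, Matrix.mul_assoc,
      Matrix.mul_assoc, hET, Matrix.mul_one]
  · rw [Matrix.mul_add, Matrix.add_mul, ← Matrix.mul_assoc A U, hAU1]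
    congr 1
    calc A * (S * E * Tᵀ) = S * (C * E) * Tᵀ := by
          rw [← Matrix.mul_assoc, ← Matrix.mul_assoc, hAS, Matrix.mul_assoc S C]
      _ = S * E * Tᵀ * B := by rw [hCE, Matrix.mul_assoc _ _ B, hTB]; simp only [Matrix.mul_assoc]

end InvariantColumns

end Matrix

/-! ### Induction on expressions -/

section Backward

namespace SizeSym

/-- The part index of a row of an object whose number of rows is given by a size symbol; an object
with a single row has a single part. -/
def partIndex {n l : ℕ} (p : Fin n → Fin l) : (a : SizeSym) → Fin (a.toNat n) → Fin (a.toNat l)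
  | one => id
  | size => p

/-- The `0/1` matrix whose columns are the indicator vectors of the parts. -/
def partMatrix {n l : ℕ} (p : Fin n → Fin l) (a : SizeSym) :
    Matrix (Fin (a.toNat n)) (Fin (a.toNat l)) ℂ :=
  (1 : Matrix (Fin (a.toNat l)) (Fin (a.toNat l)) ℂ).submatrix (partIndex p a) id

/-- `O` in size `n`, and the identity in size `1`. -/
def extendByOne {n : ℕ} (O : Matrix (Fin n) (Fin n) ℂ) :
    (a : SizeSym) → Matrix (Fin (a.toNat n)) (Fin (a.toNat n)) ℂ
  | one => 1
  | size => O

theorem partMatrix_mul {n l : ℕ} {κ : Type*} (p : Fin n → Fin l) (a : SizeSym)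
    (C : Matrix (Fin (a.toNat l)) κ ℂ) :
    partMatrix p a * C = C.submatrix (partIndex p a) id :=
  Matrix.one_submatrix_mul_eq_submatrix _ _

end SizeSym

open SizeSym

variable {n l : ℕ}

/-- `M` is intertwined with `N` by `O`, and both `M` and its conjugate transpose map vectors that
are constant on parts to such vectors. -/
structure PartCompatible (p : Fin n → Fin l) (O : Matrix (Fin n) (Fin n) ℂ) {a b : SizeSym}
    (M N : Matrix (Fin (a.toNat n)) (Fin (b.toNat n)) ℂ) : Prop where
  intertwine : M * extendByOne O b = extendByOne O a * N
  map_parts : ∃ C : Matrix (Fin (a.toNat l)) (Fin (b.toNat l)) ℂ,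
    M * partMatrix p b = partMatrix p a * C
  conj_map_parts : ∃ C : Matrix (Fin (b.toNat l)) (Fin (a.toNat l)) ℂ,
    Mᴴ * partMatrix p a = partMatrix p b * C

variable {p q : Fin n → Fin l} {O : Matrix (Fin n) (Fin n) ℂ}

theorem extendByOne_mul_conjTranspose (hO : O * Oᴴ = 1) (a : SizeSym) :
    extendByOne O a * (extendByOne O a)ᴴ = 1 := by
  cases a
  · simp [extendByOne]
  · exact hO

theorem extendByOne_conjTranspose_mul (hO : O * Oᴴ = 1) (a : SizeSym) :
    (extendByOne O a)ᴴ * extendByOne O a = 1 :=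
  mul_eq_one_comm.1 (extendByOne_mul_conjTranspose hO a)

theorem partMatrix_eq_extendByOne_mul
    (hpq : partMatrix p SizeSym.size = O * partMatrix q SizeSym.size) (a : SizeSym) :
    partMatrix p a = extendByOne O a * partMatrix q a := by
  cases a
  · exact (Matrix.one_mul _).symm
  · exact hpq

namespace PartCompatible

variable {a b c : SizeSym}

theorem eq_left {M N : Matrix (Fin (a.toNat n)) (Fin (b.toNat n)) ℂ} (hO : O * Oᴴ = 1)
    (h : PartCompatible p O M N) : M = extendByOne O a * N * (extendByOne O b)ᴴ := by
  rw [← h.intertwine, Matrix.mul_assoc, extendByOne_mul_conjTranspose hO, Matrix.mul_one]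

theorem mul {M N : Matrix (Fin (a.toNat n)) (Fin (b.toNat n)) ℂ}
    {M' N' : Matrix (Fin (b.toNat n)) (Fin (c.toNat n)) ℂ}
    (h : PartCompatible p O M N) (h' : PartCompatible p O M' N') :
    PartCompatible p O (M * M') (N * N') := by
  obtain ⟨h1, ⟨C, h2⟩, D, h3⟩ := h
  obtain ⟨h1', ⟨C', h2'⟩, D', h3'⟩ := h'
  refine ⟨?_, ⟨C * C', ?_⟩, D' * D, ?_⟩
  · rw [Matrix.mul_assoc, h1', ← Matrix.mul_assoc, h1, Matrix.mul_assoc]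
  · rw [Matrix.mul_assoc, h2', ← Matrix.mul_assoc, h2, Matrix.mul_assoc]
  · rw [Matrix.conjTranspose_mul, Matrix.mul_assoc, h3, ← Matrix.mul_assoc, h3', Matrix.mul_assoc]

theorem conjTranspose {M N : Matrix (Fin (a.toNat n)) (Fin (b.toNat n)) ℂ} (hO : O * Oᴴ = 1)
    (h : PartCompatible p O M N) : PartCompatible p O Mᴴ Nᴴ := by
  refine ⟨?_, h.conj_map_parts, by simpa using h.map_parts⟩
  rw [h.eq_left hO, Matrix.conjTranspose_mul, Matrix.conjTranspose_mul,
    Matrix.conjTranspose_conjTranspose, Matrix.mul_assoc, Matrix.mul_assoc,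
    extendByOne_conjTranspose_mul hO, Matrix.mul_one]

theorem trace_eq {M N : Matrix (Fin (a.toNat n)) (Fin (a.toNat n)) ℂ} (hO : O * Oᴴ = 1)
    (h : PartCompatible p O M N) : M.trace = N.trace := by
  rw [h.eq_left hO, Matrix.trace_mul_cycle, extendByOne_conjTranspose_mul hO, Matrix.one_mul]

theorem of_scalar (x : Matrix (Fin 1) (Fin 1) ℂ) :
    PartCompatible p O (a := SizeSym.one) (b := SizeSym.one) x x :=
  ⟨(Matrix.mul_one x).trans (Matrix.one_mul x).symm,
    ⟨x, (Matrix.mul_one x).trans (Matrix.one_mul x).symm⟩,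
    ⟨xᴴ, (Matrix.mul_one xᴴ).trans (Matrix.one_mul xᴴ).symm⟩⟩

theorem of_column (hpq : partMatrix p SizeSym.size = O * partMatrix q SizeSym.size)
    (C : Matrix (Fin (a.toNat l)) (Fin 1) ℂ) :
    PartCompatible p O (b := SizeSym.one) (partMatrix p a * C) (partMatrix q a * C) :=
  ⟨(Matrix.mul_one _).trans
      (by rw [partMatrix_eq_extendByOne_mul hpq, Matrix.mul_assoc]),
    ⟨C, Matrix.mul_one _⟩, ⟨_, (Matrix.one_mul _).symm⟩⟩

/-- The coefficients of `M` on the parts transfer to `N` by cancelling the unitary matrix. -/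
theorem exists_column {M N : Matrix (Fin (a.toNat n)) (Fin 1) ℂ} (hO : O * Oᴴ = 1)
    (hpq : partMatrix p SizeSym.size = O * partMatrix q SizeSym.size)
    (h : PartCompatible p O (b := SizeSym.one) M N) :
    ∃ C : Matrix (Fin (a.toNat l)) (Fin 1) ℂ, M = partMatrix p a * C ∧ N = partMatrix q a * C := by
  obtain ⟨C, hC⟩ := h.map_parts
  have hM : M = partMatrix p a * C := (Matrix.mul_one M).symm.trans hC
  refine ⟨C, hM, ?_⟩
  have h1 : M = extendByOne O a * N := (Matrix.mul_one M).symm.trans h.intertwine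
  calc N = (extendByOne O a)ᴴ * (extendByOne O a * N) := by
        rw [← Matrix.mul_assoc, extendByOne_conjTranspose_mul hO, Matrix.one_mul]
    _ = (extendByOne O a)ᴴ * (extendByOne O a * (partMatrix q a * C)) := by
        rw [← h1, hM, partMatrix_eq_extendByOne_mul hpq a, Matrix.mul_assoc]
    _ = partMatrix q a * C := by
        rw [← Matrix.mul_assoc, extendByOne_conjTranspose_mul hO, Matrix.one_mul]

/-- Every expression of the fragment maintains compatibility with the partitions. -/
theorem eval {A B : Matrix (Fin n) (Fin n) ℂ} (hO : O * Oᴴ = 1)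
    (hpq : partMatrix p SizeSym.size = O * partMatrix q SizeSym.size)
    (hAB : PartCompatible p O (a := SizeSym.size) (b := SizeSym.size) A B)
    (e : MLExpr a b) : PartCompatible p O (e.eval A) (e.eval B) := by
  induction e with
  | var => exact hAB
  | mul e₁ e₂ h₁ h₂ => exact h₁.mul h₂
  | tr e h =>
    simp only [MLExpr.eval, h.trace_eq hO]
    exact of_scalar _
  | conjT e h => exact h.conjTranspose hO
  | @ones a _ e h =>
    have := of_column (p := p) hpq (Matrix.of fun (_ : Fin (a.toNat l)) _ => 1)
    rwa [partMatrix_mul, partMatrix_mul] at this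
  -- Vectors constant on parts multiply coefficientwise, with the same coefficients on both sides.
  | vmul e₁ e₂ h₁ h₂ =>
    obtain ⟨C, h1, h2⟩ := h₁.exists_column hO hpq
    obtain ⟨D, h3, h4⟩ := h₂.exists_column hO hpq
    have := of_column (p := p) hpq (Matrix.of fun i j => C i j * D i j)
    simp only [MLExpr.eval, h1, h2, h3, h4]
    simp only [partMatrix_mul] at this ⊢
    exact this

end PartCompatible

/-- An orthogonal matrix which preserves a common equitable partition and intertwines `A` and `B`
makes them equivalent. -/
theorem mlMatrixEquiv_of_partCompatible {A B : Matrix (Fin n) (Fin n) ℂ} (hO : O * Oᴴ = 1)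
    (hpq : partMatrix p SizeSym.size = O * partMatrix q SizeSym.size)
    (hAB : PartCompatible p O (a := SizeSym.size) (b := SizeSym.size) A B) :
    MLMatrixEquiv A B := fun e => by
  have h := (hAB.eval hO hpq e).intertwine
  exact (Matrix.mul_one (e.eval A)).symm.trans (h.trans (Matrix.one_mul (e.eval B)))

end Backward

/-! ### Power traces as sentences -/

/-- The expression `X ^ (k + 1)`. -/
def MLExpr.varPow : ℕ → MLExpr SizeSym.size SizeSym.size
  | 0 => .var
  | k + 1 => .mul (varPow k) .var

theorem MLExpr.eval_varPow {n : ℕ} (A : Matrix (Fin n) (Fin n) ℂ) (k : ℕ) :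
    (varPow k).eval A = A ^ (k + 1) := by
  induction k with
  | zero => simp [varPow, MLExpr.eval]
  | succ k ih => rw [varPow, MLExpr.eval, ih, pow_succ _ (k + 1)]; rfl

theorem MLMatrixEquiv.trace_pow_eq {n : ℕ} {A B : Matrix (Fin n) (Fin n) ℂ}
    (h : MLMatrixEquiv A B) (k : ℕ) : (A ^ k).trace = (B ^ k).trace := by
  cases k with
  -- No sentence is needed here: both traces equal the order.
  | zero => simp
  | succ k =>
    have := congrFun (congrFun (h (.tr (MLExpr.varPow k))) 0) 0
    simp only [MLExpr.eval, Matrix.of_apply, MLExpr.eval_varPow] at this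
    exact this

/-! ### Equitable partitions in matrix form -/

section Graphs

variable {n l : ℕ} {G : SimpleGraph (Fin n)} [DecidableRel G.Adj] {V : Fin l → Finset (Fin n)}

theorem adjMatrix_map_ofReal (G : SimpleGraph (Fin n)) [DecidableRel G.Adj] :
    (G.adjMatrix ℝ).map Complex.ofRealHom = G.adjMatrix ℂ := by
  ext i j
  simp only [Matrix.map_apply, SimpleGraph.adjMatrix_apply]
  split_ifs <;> simp

theorem MLGraphEquiv.trace_adjMatrix_pow_eq {H : SimpleGraph (Fin n)} [DecidableRel H.Adj]
    (h : MLGraphEquiv G H) (k : ℕ) :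
    ((G.adjMatrix ℝ) ^ k).trace = ((H.adjMatrix ℝ) ^ k).trace := by
  have h1 : ∀ (K : SimpleGraph (Fin n)) [DecidableRel K.Adj],
      ((K.adjMatrix ℂ) ^ k).trace = ((((K.adjMatrix ℝ) ^ k).trace : ℝ) : ℂ) := fun K _ => by
    rw [← adjMatrix_map_ofReal, ← RingHom.mapMatrix_apply, ← map_pow]
    exact (AddMonoidHom.map_trace Complex.ofRealHom.toAddMonoidHom _).symm
  have := MLMatrixEquiv.trace_pow_eq h k
  rw [h1, h1] at this
  exact_mod_cast this

theorem IsEquitablePartition.exists_index (hV : IsEquitablePartition G V) :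
    ∃ p : Fin n → Fin l, ∀ v i, v ∈ V i ↔ p v = i := by
  choose p hp using hV.cover
  refine ⟨p, fun v i => ⟨fun h => ?_, fun h => h ▸ hp v⟩⟩
  by_contra hne
  exact Finset.disjoint_left.1 (hV.disjoint _ _ hne) (hp v) h

variable {p : Fin n → Fin l}

theorem adjMatrix_mul_partition (R : Type*) [Semiring R] (hp : ∀ v i, v ∈ V i ↔ p v = i)
    {d : Fin l → Fin l → ℕ} (hd : ∀ v j, degInto G v (V j) = d (p v) j) :
    G.adjMatrix R * (1 : Matrix (Fin l) (Fin l) R).submatrix p id =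
      (1 : Matrix (Fin l) (Fin l) R).submatrix p id * Matrix.of fun i j => (d i j : R) := by
  rw [Matrix.one_submatrix_mul_eq_submatrix]
  ext v j
  simp only [Matrix.mul_apply, SimpleGraph.adjMatrix_apply, Matrix.submatrix_apply, id,
    Matrix.one_apply, Matrix.of_apply, ← hp, ite_mul, one_mul, zero_mul, ← ite_and]
  rw [Finset.sum_boole, ← hd, degInto]
  congr 2
  ext u
  simp [and_comm]

theorem gram_partition (hp : ∀ v i, v ∈ V i ↔ p v = i) :
    ((1 : Matrix (Fin l) (Fin l) ℝ).submatrix p id)ᵀ *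
        (1 : Matrix (Fin l) (Fin l) ℝ).submatrix p id =
      Matrix.diagonal fun i => ((V i).card : ℝ) := by
  ext i j
  simp only [Matrix.mul_apply, Matrix.transpose_apply, Matrix.submatrix_apply, id,
    Matrix.one_apply, Matrix.diagonal_apply, mul_ite, mul_one, mul_zero, ← ite_and]
  split_ifs with hij
  · subst hij
    rw [Finset.sum_boole]
    congr 2
    ext v
    simp [hp]
  · exact Finset.sum_eq_zero fun v _ => if_neg fun h => hij (h.2.symm.trans h.1)

theorem preservesPartitions_iff {W : Fin l → Finset (Fin n)} {q : Fin n → Fin l}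
    (hp : ∀ v i, v ∈ V i ↔ p v = i) (hq : ∀ v i, v ∈ W i ↔ q v = i)
    (O : Matrix (Fin n) (Fin n) ℝ) :
    PreservesPartitions O V W ↔ (1 : Matrix (Fin l) (Fin l) ℝ).submatrix p id =
      O * (1 : Matrix (Fin l) (Fin l) ℝ).submatrix q id := by
  have h1 : ∀ v i, indicatorVec (V i) v = (1 : Matrix (Fin l) (Fin l) ℝ) (p v) i := fun v i => by
    simp only [indicatorVec, hp, Matrix.one_apply]
  have h2 : ∀ v i, indicatorVec (W i) v = (1 : Matrix (Fin l) (Fin l) ℝ) (q v) i := fun v i => by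
    simp only [indicatorVec, hq, Matrix.one_apply]
  simp only [PreservesPartitions, funext_iff, ← Matrix.ext_iff, Matrix.mulVec, dotProduct, h1, h2,
    Matrix.mul_apply, Matrix.submatrix_apply]
  exact forall_comm

theorem WitnessCommonEquitablePartition.exists_deg {H : SimpleGraph (Fin n)} [DecidableRel H.Adj]
    {W : Fin l → Finset (Fin n)} {q : Fin n → Fin l}
    (h : WitnessCommonEquitablePartition G H V W) (hp : ∀ v i, v ∈ V i ↔ p v = i)
    (hq : ∀ v i, v ∈ W i ↔ q v = i) :
    ∃ d : Fin l → Fin l → ℕ, (∀ v j, degInto G v (V j) = d (p v) j) ∧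
      ∀ w j, degInto H w (W j) = d (q w) j := by
  -- Representatives of the parts of `H` supply the common degrees.
  choose r hr using h.right.nonempty
  refine ⟨fun i j => degInto H (r i) (W j), fun v j => h.deg_eq _ _ _ ((hp _ _).2 rfl) _ (hr _),
    fun w j => ?_⟩
  exact h.right.deg_eq _ _ _ ((hq _ _).2 rfl) _ (hr _)

end Graphs

theorem mainTheorem5 {n l : ℕ} (G H : SimpleGraph (Fin n))
    [DecidableRel G.Adj] [DecidableRel H.Adj] (V W : Fin l → Finset (Fin n))
    (hVW : WitnessCommonEquitablePartition G H V W) :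
    MLGraphEquiv G H ↔
      ∃ O : Matrix (Fin n) (Fin n) ℝ, O ∈ Matrix.orthogonalGroup (Fin n) ℝ ∧
        PreservesPartitions O V W ∧ G.adjMatrix ℝ * O = O * H.adjMatrix ℝ := by
  obtain ⟨p, hp⟩ := hVW.left.exists_index
  obtain ⟨q, hq⟩ := hVW.right.exists_index
  obtain ⟨d, hdG, hdH⟩ := hVW.exists_deg hp hq
  constructor
  · intro h
    obtain ⟨O, hO, hS, hAO⟩ := Matrix.exists_orthogonal_of_invariant_columns
      (S := (1 : Matrix (Fin l) (Fin l) ℝ).submatrix p id)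
      (T := (1 : Matrix (Fin l) (Fin l) ℝ).submatrix q id)
      (by rw [gram_partition hp, gram_partition hq]; simp only [hVW.card_eq])
      (by
        rw [gram_partition hp, Matrix.det_diagonal, isUnit_iff_ne_zero, Finset.prod_ne_zero_iff]
        intro i _
        exact_mod_cast (Finset.card_pos.2 (hVW.left.nonempty i)).ne')
      G.transpose_adjMatrix H.transpose_adjMatrix
      (adjMatrix_mul_partition ℝ hp hdG) (adjMatrix_mul_partition ℝ hq hdH)
      h.trace_adjMatrix_pow_eq
    exact ⟨O, hO, (preservesPartitions_iff hp hq O).2 hS, hAO⟩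
  · rintro ⟨O, hO, hS, hAO⟩
    rw [preservesPartitions_iff hp hq] at hS
    have hOO : O * Oᵀ = 1 := (Matrix.mem_orthogonalGroup_iff _ _).1 hO
    have hsub : ∀ r : Fin n → Fin l, ((1 : Matrix (Fin l) (Fin l) ℝ).submatrix r id).map
        Complex.ofRealHom = SizeSym.partMatrix r SizeSym.size := fun r => by
      ext i j
      simp [SizeSym.partMatrix, SizeSym.partIndex, Matrix.one_apply, apply_ite]
    have hA := adjMatrix_mul_partition ℂ hp hdG
    refine mlMatrixEquiv_of_partCompatible (p := p) (q := q) (O := O.map Complex.ofRealHom)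
      ?_ ?_ ⟨?_, ⟨_, hA⟩, ⟨Matrix.of fun i j => (d i j : ℂ), ?_⟩⟩
    · have h1 : (O.map Complex.ofRealHom)ᴴ = Oᵀ.map Complex.ofRealHom := by
        ext i j
        simp
      rw [h1, ← Matrix.map_mul, hOO]
      exact Matrix.map_one _ (map_zero _) (map_one _)
    · rw [← hsub, ← hsub, hS, Matrix.map_mul]
    · have := congrArg (fun M => M.map Complex.ofRealHom) hAO
      simp only [Matrix.map_mul, adjMatrix_map_ofReal] at this
      exact this
    -- The adjacency matrix is Hermitian, so the adjoint condition repeats the direct one.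
    · have hG : (G.adjMatrix ℂ)ᴴ = G.adjMatrix ℂ := by
        ext i j
        simp [SimpleGraph.adjMatrix_apply, apply_ite, G.adj_comm]
      rw [hG]
      exact hA
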